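/- Let $(X,\mathcal B_X,\mu)$ and $(Y,\mathcal B_Y,\nu)$ be finite measure spaces. The measure algebra $\mathcal M_X$ is the set of classes of elements of $\mathcal B_X$ modulo $\mu$-null sets, with the metric $d(A,B)=\mu(A\,\triangle\,B)$, the measure $\mu$ and the Boolean operations inherited from representatives; $\mathcal M_Y$ is defined likewise from $\nu$. It is separable if it is a separable metric space, and nonatomic if the measure has no atoms, an atom of $\mu$ being a measurable set $A$ with $\mu(A)>0$ such that every measurable $B\subseteq A$ satisfies $\mu(B)=\mu(A)$ or $\mu(B)=0$. A measure algebra map $S:\mathcal M_Y\to\mathcal M_X$ is a map with $S(Y)=X$, $S(\emptyset)=\emptyset$, $S(A\cup B)=S(A)\cup S(B)$, $S(Y\setminus A)=X\setminus S(A)$ and $\mu(S(A))=\nu(A)$ for all $A,B\in\mathcal M_Y$; it is an isomorphism if it has a two-sided inverse which is a measure algebra map $\mathcal M_X\to\mathcal M_Y$. Let $\mathcal S(\mathcal M_Y,\mathcal M_X)$ be the set of measure algebra maps with the topology of pointwise convergence, and $\mathcal S_{iso}(\mathcal M_Y,\mathcal M_X)$ the subset of isomorphisms. If $\mathcal M_Y$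 and $\mathcal M_X$ are separable and nonatomic, then $\mathcal S(\mathcal M_Y,\mathcal M_X)$ is completely metrizable and $\mathcal S_{iso}(\mathcal M_Y,\mathcal M_X)$ is a dense $G_\delta$ subset of it. Thus the generic measure algebra map is invertible, i.e. $\mathcal S_{iso}(\mathcal M_Y,\mathcal M_X)$ is residual in $\mathcal S(\mathcal M_Y,\mathcal M_X)$ (contains a countable intersection of dense open sets). -/

import Mathlib

open MeasureTheory Topology TopologicalSpace
open scoped symmDiff ENNReal

/-- A measurable set `A` is an atom of `μ` if it has positive measure and each of its measurable
subsets has either full measure in `A` or measure zero. -/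
def IsMeasureAtom {X : Type*} [MeasurableSpace X] (μ : Measure X) (A : Set X) : Prop :=
  MeasurableSet A ∧ 0 < μ A ∧
    ∀ B : Set X, MeasurableSet B → B ⊆ A → μ B = μ A ∨ μ B = 0

/-- A measure is nonatomic if it has no atoms. (This is not Mathlib's `NoAtoms`, which only
asks for singletons to be null.) -/
def IsNonatomic {X : Type*} [MeasurableSpace X] (μ : Measure X) : Prop :=
  ∀ A : Set X, ¬ IsMeasureAtom μ A

/-- The measure algebra of `μ`: measurable sets modulo null sets, i.e. the metric quotient of the
space of measurable sets with the pseudo-distance `d(A, B) = μ (A ∆ B)`. -/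
abbrev MeasureAlgebra {X : Type*} [MeasurableSpace X] (μ : Measure X) : Type _ :=
  SeparationQuotient (MeasuredSets μ)

namespace MeasureAlgebra

variable {X : Type*} [MeasurableSpace X] {μ : Measure X}

theorem inseparable_iff (s t : MeasuredSets μ) :
    Inseparable s t ↔ μ ((s : Set X) ∆ (t : Set X)) = 0 := by
  rw [EMetric.inseparable_iff, MeasuredSets.edist_def]

/-- The class of the empty set. -/
noncomputable instance : Bot (MeasureAlgebra μ) :=
  ⟨SeparationQuotient.mk (⟨∅, MeasurableSet.empty⟩ : MeasuredSets μ)⟩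

/-- The class of the whole space. -/
noncomputable instance : Top (MeasureAlgebra μ) :=
  ⟨SeparationQuotient.mk (⟨Set.univ, MeasurableSet.univ⟩ : MeasuredSets μ)⟩

/-- The union of two classes, computed on representatives. -/
noncomputable instance : Max (MeasureAlgebra μ) where
  max := Quotient.map₂
    (fun s t : MeasuredSets μ => (⟨s.1 ∪ t.1, s.2.union t.2⟩ : MeasuredSets μ)) (by
      intro s s' hs t t' ht
      refine (inseparable_iff _ _).2 (measure_mono_null ?_ (measure_union_null
        ((inseparable_iff _ _).1 hs) ((inseparable_iff _ _).1 ht)))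
      exact Set.union_symmDiff_union_subset)

/-- The complement of a class, computed on representatives. -/
noncomputable instance : Compl (MeasureAlgebra μ) where
  compl := Quotient.map
    (fun s : MeasuredSets μ => (⟨s.1ᶜ, s.2.compl⟩ : MeasuredSets μ)) (by
      intro s s' hs
      refine (inseparable_iff _ _).2 ?_
      have h := (inseparable_iff _ _).1 hs
      change μ ((s.1)ᶜ ∆ (s'.1)ᶜ) = 0
      rw [compl_symmDiff_compl]
      exact h)

/-- The measure of a class, computed on a representative. -/
noncomputable def measure : MeasureAlgebra μ → ℝ≥0∞ :=
  SeparationQuotient.lift (fun s : MeasuredSets μ => μ (s : Set X))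
    (fun _ _ h => (h.map MeasuredSets.continuous_measure).eq)

end MeasureAlgebra

/-- A measure algebra map from the measure algebra of `ν` to the measure algebra of `μ`. -/
structure MeasureAlgebraMap {Y X : Type*} [MeasurableSpace Y] [MeasurableSpace X]
    (ν : Measure Y) (μ : Measure X) where
  toFun : MeasureAlgebra ν → MeasureAlgebra μ
  map_top : toFun ⊤ = ⊤
  map_bot : toFun ⊥ = ⊥
  map_sup : ∀ A B, toFun (A ⊔ B) = toFun A ⊔ toFun B
  map_compl : ∀ A, toFun Aᶜ = (toFun A)ᶜ
  measure_map : ∀ A, MeasureAlgebra.measure (toFun A) = MeasureAlgebra.measure A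

namespace MeasureAlgebraMap

variable {Y X : Type*} [MeasurableSpace Y] [MeasurableSpace X] {ν : Measure Y} {μ : Measure X}

/-- The topology of pointwise convergence: the one induced from the product topology on
the functions between the two metric spaces. -/
noncomputable instance : TopologicalSpace (MeasureAlgebraMap ν μ) :=
  TopologicalSpace.induced (fun S A => S.toFun A) Pi.topologicalSpace

/-- A measure algebra map is an isomorphism if it has a two-sided inverse that is a
measure algebra map. -/
def IsIso (S : MeasureAlgebraMap ν μ) : Prop :=
  ∃ T : MeasureAlgebraMap μ ν, Function.LeftInverse T.toFun S.toFun ∧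
    Function.RightInverse T.toFun S.toFun

end MeasureAlgebraMap

/-!
The density of the isomorphisms is the heart of the matter. Let a measure algebra map `S` and
finitely many classes in the measure algebra of `ν` be given. They are resolved by a finite
partition of `Y`, which `S` carries to a partition of `X` with cells of the same measures
(`MeasureAlgebraMap.exists_coding`). By Sierpiński's theorem
(`IsNonatomic.exists_subset_measure_eq`), whenever one of two such partitions is refined by a
set, the other one can be refined so that the measures of the cells still agree. Going back and
forth along dense sequences of the two measure algebras, one gets refining sequences of partitions
of `Y` and `X` with equal distributions. They are recorded by maps from `Y` and `X` to `ℕ → ℕ`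
with the same image measure `m`. Taking preimages under each of these maps gives a measure algebra
map out of the measure algebra of `m` which has dense range and so is an isomorphism. The
composition of one of them with the inverse of the other is an isomorphism that agrees with `S` on
the given classes (`MeasureAlgebraMap.exists_isIso_eqOn`).

The rest is metric topology. Measure algebra maps are isometries between complete metric spaces.
Hence restriction to a dense sequence `D` is a closed embedding of the space of measure algebra maps
into the countable power of the target (`isInducing_restrict`, `isClosed_range_restrict`), which
gives complete metrizability. Moreover the range of a measure algebra map is closed, so that the
map is invertible if and only if its range is dense (`isIso_iff_denseRange`). That the range comes
within `1 / (k + 1)` of the `n`-th term of a dense sequence is an open condition, so the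
isomorphisms form a `Gδ` set.
-/

/-! ### The intermediate value property of nonatomic measures -/

section Nonatomic

variable {X : Type*} [MeasurableSpace X] {μ : Measure X}

namespace IsNonatomic

/-- A set of positive measure contains a set whose measure is positive and at most half as big:
a set witnessing that it is not an atom, or the relative complement of this set. -/
theorem exists_subset_le_half (hμ : IsNonatomic μ) {Q : Set X} (hQ : MeasurableSet Q)
    (h0 : 0 < μ Q) : ∃ B ⊆ Q, MeasurableSet B ∧ 0 < μ B ∧ 2 * μ B ≤ μ Q := by
  have h := hμ Q
  simp only [IsMeasureAtom, hQ, h0, true_and, not_forall, not_or] at h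
  obtain ⟨C, hC, hCQ, h1, h2⟩ := h
  have hadd : μ C + μ (Q \ C) = μ Q := by
    rw [← measure_inter_add_sdiff Q hC, Set.inter_eq_self_of_subset_right hCQ]
  rcases le_total (μ C) (μ (Q \ C)) with hle | hle
  · refine ⟨C, hCQ, hC, pos_iff_ne_zero.2 h2, ?_⟩
    rw [← hadd, two_mul]
    gcongr
  · refine ⟨Q \ C, Set.sdiff_subset, hQ.diff hC, pos_iff_ne_zero.2 fun h3 => ?_, ?_⟩
    · rw [h3, add_zero] at hadd
      exact h1 hadd
    · rw [← hadd, two_mul]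
      gcongr

theorem exists_subset_lt [IsFiniteMeasure μ] (hμ : IsNonatomic μ) {Q : Set X} (hQ : MeasurableSet Q)
    (h0 : 0 < μ Q) {ε : ℝ≥0∞} (hε : 0 < ε) :
    ∃ B ⊆ Q, MeasurableSet B ∧ 0 < μ B ∧ μ B < ε := by
  have key : ∀ n : ℕ, ∃ B ⊆ Q, MeasurableSet B ∧ 0 < μ B ∧ 2 ^ n * μ B ≤ μ Q := by
    intro n
    induction n with
    | zero => exact ⟨Q, subset_rfl, hQ, h0, by simp⟩
    | succ n ih =>
      obtain ⟨B, hBQ, hB, hB0, hle⟩ := ih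
      obtain ⟨C, hCB, hC, hC0, hCle⟩ := hμ.exists_subset_le_half hB hB0
      refine ⟨C, hCB.trans hBQ, hC, hC0, ?_⟩
      calc 2 ^ (n + 1) * μ C = 2 ^ n * (2 * μ C) := by ring
        _ ≤ 2 ^ n * μ B := by gcongr
        _ ≤ μ Q := hle
  obtain ⟨n, hn⟩ := ENNReal.exists_nat_mul_gt hε.ne' (measure_ne_top μ Q)
  obtain ⟨B, hBQ, hB, hB0, hle⟩ := key n
  refine ⟨B, hBQ, hB, hB0, ?_⟩
  by_contra! hge
  have h2 : (n : ℝ≥0∞) ≤ 2 ^ n := by exact_mod_cast Nat.lt_two_pow_self.le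
  exact absurd (hn.trans_le ((mul_le_mul' h2 hge).trans hle)) (lt_irrefl _)

/-- **Sierpiński's theorem**: a nonatomic finite measure takes on the measurable subsets of `Q` all
values between `0` and `μ Q`. A subset of measure `t` is the union of a greedy sequence of subsets
of measure at most `t`, in which each step achieves at least half of the possible gain. -/
theorem exists_subset_measure_eq [IsFiniteMeasure μ] (hμ : IsNonatomic μ) {Q : Set X}
    (hQ : MeasurableSet Q) {t : ℝ≥0∞} (ht : t ≤ μ Q) : ∃ B ⊆ Q, MeasurableSet B ∧ μ B = t := by
  have htop : t ≠ ∞ := (ht.trans_lt (measure_lt_top μ Q)).ne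
  let P := {B : Set X // MeasurableSet B ∧ B ⊆ Q ∧ μ B ≤ t}
  have step : ∀ B : P, ∃ B' : P, B.1 ⊆ B'.1 ∧
      ∀ D : P, B.1 ⊆ D.1 → μ D.1 + μ B.1 ≤ 2 * μ B'.1 := by
    intro B
    set r : ℝ≥0∞ := ⨆ D : {D : P // B.1 ⊆ D.1}, μ D.1.1 with hr
    have hle : ∀ D : P, B.1 ⊆ D.1 → μ D.1 ≤ r := fun D hD =>
      le_iSup (fun D : {D : P // B.1 ⊆ D.1} => μ D.1.1) ⟨D, hD⟩
    have hrt : r ≤ t := iSup_le fun D => D.1.2.2.2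
    rcases (hle B subset_rfl).eq_or_lt with heq | hlt
    · refine ⟨B, subset_rfl, fun D hD => ?_⟩
      rw [two_mul]
      exact add_le_add_left ((hle D hD).trans heq.ge) _
    · have hmid : (r + μ B.1) / 2 < r := by
        rw [ENNReal.div_lt_iff (by simp) (by simp), mul_two]
        exact ENNReal.add_lt_add_left (hrt.trans_lt htop.lt_top).ne hlt
      obtain ⟨⟨B', hBB'⟩, hB'⟩ := lt_iSup_iff.1 (hr ▸ hmid)
      refine ⟨B', hBB', fun D hD => ?_⟩
      rw [ENNReal.div_lt_iff (by simp) (by simp), mul_comm] at hB'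
      exact (add_le_add_left (hle D hD) _).trans hB'.le
  choose next hnext hgain using step
  let B : ℕ → P := fun n => next^[n] ⟨∅, by simp⟩
  have hBs : ∀ n, B (n + 1) = next (B n) := fun n => Function.iterate_succ_apply' _ _ _
  have hmono : Monotone fun n => (B n).1 := monotone_nat_of_le_succ fun n => by
    rw [hBs]; exact hnext _
  have hlim := tendsto_measure_iUnion_atTop (μ := μ) hmono
  have hLm : MeasurableSet (⋃ n, (B n).1) := .iUnion fun n => (B n).2.1
  have hLQ : (⋃ n, (B n).1) ⊆ Q := Set.iUnion_subset fun n => (B n).2.2.1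
  have hLt : μ (⋃ n, (B n).1) ≤ t := le_of_tendsto' hlim fun n => (B n).2.2.2
  set L := ⋃ n, (B n).1 with hL
  refine ⟨L, hLQ, hLm, hLt.antisymm ?_⟩
  by_contra! hlt
  have hpos : 0 < μ (Q \ L) := by
    rw [measure_sdiff hLQ hLm.nullMeasurableSet (measure_ne_top _ _)]
    exact tsub_pos_of_lt (hlt.trans_le ht)
  -- a set `D` disjoint from `L` that could have been added at every step
  obtain ⟨D, hDQ, hD, hD0, hDt⟩ := hμ.exists_subset_lt (hQ.diff hLm) hpos (tsub_pos_of_lt hlt)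
  have hLD : μ (L ∪ D) = μ L + μ D :=
    measure_union (Set.disjoint_of_subset_right hDQ Set.disjoint_sdiff_right) hD
  let E : P := ⟨L ∪ D, hLm.union hD, Set.union_subset hLQ (hDQ.trans Set.sdiff_subset), by
    rw [hLD, add_comm]
    exact (lt_tsub_iff_right.1 hDt).le⟩
  have hbound : ∀ n, μ (L ∪ D) + μ (B n).1 ≤ 2 * μ L := fun n =>
    (hgain (B n) E
        ((Set.subset_iUnion (fun n => (B n).1) n).trans Set.subset_union_left)).trans <| by
      rw [← hBs]
      gcongr
      exact Set.subset_iUnion (fun n => (B n).1) (n + 1)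
  have h2 : μ (L ∪ D) + μ L ≤ 2 * μ L := le_of_tendsto' (hlim.const_add _) hbound
  rw [two_mul, hLD, add_assoc] at h2
  have h3 := ENNReal.le_of_add_le_add_left (measure_ne_top μ L) h2
  exact absurd (h3.trans_lt (ENNReal.lt_add_right (measure_ne_top μ L) hD0.ne'))
    (by rw [add_comm]; exact lt_irrefl _)

end IsNonatomic

end Nonatomic

/-! ### Finite partitions coded by natural numbers -/

section Coding

/-- A function `φ : Y → ℕ` codes the partition of `Y` into its fibres. Appending to the binary
expansion of `φ` the indicator of `A` as a last digit codes the partition refined by `A`. -/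
noncomputable def appendBit {Y : Type*} (φ : Y → ℕ) (A : Set Y) (y : Y) : ℕ :=
  open Classical in if y ∈ A then 2 * φ y + 1 else 2 * φ y

theorem appendBit_div_two {Y : Type*} (φ : Y → ℕ) (A : Set Y) (y : Y) :
    appendBit φ A y / 2 = φ y := by
  unfold appendBit
  split_ifs <;> omega

theorem preimage_appendBit {Y : Type*} (φ : Y → ℕ) (A : Set Y) (C : Set ℕ) :
    appendBit φ A ⁻¹' C =
      (φ ⁻¹' {z | 2 * z + 1 ∈ C} ∩ A) ∪ (φ ⁻¹' {z | 2 * z ∈ C} \ A) := by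
  ext y
  by_cases hy : y ∈ A <;> simp [appendBit, hy]

theorem preimage_appendBit_odd {Y : Type*} (φ : Y → ℕ) (A : Set Y) :
    appendBit φ A ⁻¹' {z | z % 2 = 1} = A := by
  ext y
  by_cases hy : y ∈ A <;> simp [appendBit, hy]

variable {Y X : Type*} [MeasurableSpace Y] [MeasurableSpace X] {ν : Measure Y} {μ : Measure X}

theorem measurable_appendBit {φ : Y → ℕ} (hφ : Measurable φ) {A : Set Y} (hA : MeasurableSet A) :
    Measurable (appendBit φ A) := by
  intro C _
  rw [preimage_appendBit]
  exact ((hφ (.of_discrete)).inter hA).union ((hφ (.of_discrete)).diff hA)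

theorem measure_preimage_eq {φ : Y → ℕ} {ψ : X → ℕ} (hφ : Measurable φ)
    (hψ : Measurable ψ) (h : ν.map φ = μ.map ψ) (C : Set ℕ) : ν (φ ⁻¹' C) = μ (ψ ⁻¹' C) := by
  rw [← Measure.map_apply hφ .of_discrete, h, Measure.map_apply hψ .of_discrete]

/-- Two partitions with the same distribution stay so when one of them is refined by a set and the
other one by a suitable set, to be found by Sierpiński's theorem inside each cell. -/
theorem IsNonatomic.exists_map_appendBit_eq [IsFiniteMeasure ν] [IsFiniteMeasure μ]
    (hμ : IsNonatomic μ) {φ : Y → ℕ} {ψ : X → ℕ} (hφ : Measurable φ)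
    (hψ : Measurable ψ) (h : ν.map φ = μ.map ψ) {A : Set Y} (hA : MeasurableSet A) :
    ∃ B, MeasurableSet B ∧ ν.map (appendBit φ A) = μ.map (appendBit ψ B) := by
  have hcell := measure_preimage_eq hφ hψ h
  have hmφ : ∀ C, MeasurableSet (φ ⁻¹' C) := fun C => hφ .of_discrete
  have hmψ : ∀ C, MeasurableSet (ψ ⁻¹' C) := fun C => hψ .of_discrete
  have hex : ∀ z : ℕ, ∃ B ⊆ ψ ⁻¹' {z}, MeasurableSet B ∧ μ B = ν (φ ⁻¹' {z} ∩ A) := fun z =>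
    hμ.exists_subset_measure_eq (hmψ _) ((measure_mono Set.inter_subset_left).trans (hcell _).le)
  choose B hBψ hB hBν using hex
  have hin : ∀ z, ψ ⁻¹' {z} ∩ ⋃ w, B w = B z := by
    intro z
    ext x
    simp only [Set.mem_inter_iff, Set.mem_preimage, Set.mem_singleton_iff, Set.mem_iUnion]
    constructor
    · rintro ⟨rfl, w, hw⟩
      have hxw : ψ x = w := hBψ w hw
      exact hxw ▸ hw
    · exact fun hx => ⟨hBψ z hx, z, hx⟩
  have hBm : MeasurableSet (⋃ w, B w) := .iUnion hB
  refine ⟨⋃ w, B w, hBm, Measure.ext_of_singleton fun c => ?_⟩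
  rw [Measure.map_apply (measurable_appendBit hφ hA) .of_discrete,
    Measure.map_apply (measurable_appendBit hψ hBm) .of_discrete, preimage_appendBit,
    preimage_appendBit]
  have h1 : ∀ z, ν (φ ⁻¹' {z} ∩ A) = μ (ψ ⁻¹' {z} ∩ ⋃ w, B w) := fun z => by rw [hin, hBν]
  have h2 : ∀ z, ν (φ ⁻¹' {z} \ A) = μ (ψ ⁻¹' {z} \ ⋃ w, B w) := fun z => by
    have h3 := measure_inter_add_sdiff (μ := ν) (φ ⁻¹' {z}) hA
    rw [hcell, ← measure_inter_add_sdiff (μ := μ) (ψ ⁻¹' {z}) hBm, h1] at h3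
    exact (ENNReal.add_right_inj (measure_ne_top _ _)).1 h3
  rcases Nat.even_or_odd' c with ⟨z, rfl | rfl⟩
  · have e1 : {w : ℕ | 2 * w + 1 ∈ ({2 * z} : Set ℕ)} = ∅ := by
      ext w; simp; omega
    have e2 : {w : ℕ | 2 * w ∈ ({2 * z} : Set ℕ)} = {z} := by
      ext w; simp
    rw [e1, e2]
    simpa using h2 z
  · have e1 : {w : ℕ | 2 * w + 1 ∈ ({2 * z + 1} : Set ℕ)} = {z} := by
      ext w; simp
    have e2 : {w : ℕ | 2 * w ∈ ({2 * z + 1} : Set ℕ)} = ∅ := by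
      ext w; simp; omega
    rw [e1, e2]
    simpa using h1 z

theorem iterate_apply_of_forall_succ {Z α : Type*} {χ : ℕ → Z → α} {g : α → α}
    (h : ∀ n z, g (χ (n + 1) z) = χ n z) (k n : ℕ) (z : Z) : g^[k] (χ (n + k) z) = χ n z := by
  induction k with
  | zero => rfl
  | succ k ih => rw [Function.iterate_succ_apply, ← add_assoc, h, ih]

/-- The distributions of two sequences of functions are equal if each term is the same function of
the next one in both sequences and the distributions of the terms are equal. -/
theorem map_sequence_eq [IsFiniteMeasure ν] {φ : ℕ → Y → ℕ} {ψ : ℕ → X → ℕ}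
    (hφ : ∀ n, Measurable (φ n)) (hψ : ∀ n, Measurable (ψ n)) (h : ∀ n, ν.map (φ n) = μ.map (ψ n))
    {g : ℕ → ℕ} (hgφ : ∀ n y, g (φ (n + 1) y) = φ n y) (hgψ : ∀ n x, g (ψ (n + 1) x) = ψ n x) :
    ν.map (fun y n => φ n y) = μ.map (fun x n => ψ n x) := by
  have hφ' : Measurable fun y n => φ n y := measurable_pi_lambda _ hφ
  have hψ' : Measurable fun x n => ψ n x := measurable_pi_lambda _ hψ
  refine IsProjectiveLimit.unique (P := fun I => (ν.map (fun y n => φ n y)).map I.restrict)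
    (fun I => rfl) fun I => ?_
  obtain ⟨N, hN⟩ := I.exists_nat_subset_range
  -- the coordinates in `I` are functions of the `N`-th one
  let f : ℕ → (I → ℕ) := fun z i => g^[N - i] z
  have hf : Measurable f := .of_discrete
  have hsub : ∀ i : I, (i : ℕ) + (N - i) = N := fun i => by
    have := Finset.mem_range.1 (hN i.2)
    omega
  have hfφ : I.restrict ∘ (fun y n => φ n y) = f ∘ φ N := by
    funext y i
    have h := iterate_apply_of_forall_succ hgφ (N - i) i y
    rw [hsub] at h
    exact h.symm
  have hfψ : I.restrict ∘ (fun x n => ψ n x) = f ∘ ψ N := by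
    funext x i
    have h := iterate_apply_of_forall_succ hgψ (N - i) i x
    rw [hsub] at h
    exact h.symm
  change (μ.map _).map _ = (ν.map _).map _
  rw [Measure.map_map (Finset.measurable_restrict I) hψ',
    Measure.map_map (Finset.measurable_restrict I) hφ', hfφ, hfψ, ← Measure.map_map hf (hψ N),
    ← Measure.map_map hf (hφ N), h]

end Coding

/-! ### The measure algebra as a metric Boolean algebra -/

namespace MeasureAlgebra

open Filter

variable {X : Type*} [MeasurableSpace X] {μ : Measure X}

/-- The class of a measurable set. -/
noncomputable def ofSet (μ : Measure X) (s : Set X) (hs : MeasurableSet s) : MeasureAlgebra μ :=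
  SeparationQuotient.mk (⟨s, hs⟩ : MeasuredSets μ)

theorem exists_ofSet_eq (A : MeasureAlgebra μ) : ∃ s, ∃ hs : MeasurableSet s, ofSet μ s hs = A := by
  obtain ⟨⟨s, hs⟩, rfl⟩ := SeparationQuotient.surjective_mk A
  exact ⟨s, hs, rfl⟩

theorem edist_ofSet {s t : Set X} (hs : MeasurableSet s) (ht : MeasurableSet t) :
    edist (ofSet μ s hs) (ofSet μ t ht) = μ (s ∆ t) := rfl

theorem measure_ofSet {s : Set X} (hs : MeasurableSet s) : (ofSet μ s hs).measure = μ s := rfl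

theorem ofSet_sup {s t : Set X} (hs : MeasurableSet s) (ht : MeasurableSet t) :
    ofSet μ s hs ⊔ ofSet μ t ht = ofSet μ (s ∪ t) (hs.union ht) := rfl

theorem ofSet_compl {s : Set X} (hs : MeasurableSet s) :
    (ofSet μ s hs)ᶜ = ofSet μ sᶜ hs.compl := rfl

theorem ofSet_congr {s t : Set X} (hs : MeasurableSet s) (h : s = t) :
    ofSet μ s hs = ofSet μ t (h ▸ hs) := by
  subst h
  rfl

theorem ofSet_inter {s t : Set X} (hs : MeasurableSet s) (ht : MeasurableSet t) :
    ofSet μ (s ∩ t) (hs.inter ht) = ((ofSet μ s hs)ᶜ ⊔ (ofSet μ t ht)ᶜ)ᶜ := by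
  rw [ofSet_compl, ofSet_compl, ofSet_sup, ofSet_compl]
  exact ofSet_congr _ (by rw [Set.compl_union, compl_compl, compl_compl])

theorem ofSet_diff {s t : Set X} (hs : MeasurableSet s) (ht : MeasurableSet t) :
    ofSet μ (s \ t) (hs.diff ht) = ((ofSet μ s hs)ᶜ ⊔ ofSet μ t ht)ᶜ := by
  rw [ofSet_compl, ofSet_sup, ofSet_compl]
  exact ofSet_congr _ (by rw [Set.compl_union, compl_compl, Set.sdiff_eq])

theorem edist_eq_measure (A B : MeasureAlgebra μ) :
    edist A B = ((Aᶜ ⊔ B)ᶜ ⊔ (Bᶜ ⊔ A)ᶜ).measure := by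
  obtain ⟨s, hs, rfl⟩ := exists_ofSet_eq A
  obtain ⟨t, ht, rfl⟩ := exists_ofSet_eq B
  rw [← ofSet_diff, ← ofSet_diff, ofSet_sup, measure_ofSet, edist_ofSet]
  rfl

theorem continuous_measure : Continuous (measure : MeasureAlgebra μ → ℝ≥0∞) :=
  MeasuredSets.continuous_measure.quotient_lift _

theorem continuous_compl : Continuous (compl : MeasureAlgebra μ → MeasureAlgebra μ) := by
  refine Isometry.continuous fun A B => ?_
  obtain ⟨s, hs, rfl⟩ := exists_ofSet_eq A
  obtain ⟨t, ht, rfl⟩ := exists_ofSet_eq B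
  rw [ofSet_compl, ofSet_compl, edist_ofSet, edist_ofSet, compl_symmDiff_compl]

theorem continuous_sup :
    Continuous fun p : MeasureAlgebra μ × MeasureAlgebra μ => p.1 ⊔ p.2 := by
  refine LipschitzWith.continuous (K := 2) fun p q => ?_
  obtain ⟨A, B⟩ := p
  obtain ⟨A', B'⟩ := q
  have h : edist (A ⊔ B) (A' ⊔ B') ≤ edist A A' + edist B B' := by
    obtain ⟨s, hs, rfl⟩ := exists_ofSet_eq A
    obtain ⟨t, ht, rfl⟩ := exists_ofSet_eq B
    obtain ⟨s', hs', rfl⟩ := exists_ofSet_eq A'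
    obtain ⟨t', ht', rfl⟩ := exists_ofSet_eq B'
    rw [ofSet_sup, ofSet_sup, edist_ofSet, edist_ofSet, edist_ofSet]
    exact (measure_mono Set.union_symmDiff_union_subset).trans (measure_union_le _ _)
  refine h.trans ?_
  rw [Prod.edist_eq, ENNReal.coe_ofNat, two_mul]
  exact add_le_add (le_max_left _ _) (le_max_right _ _)

/-- A sequence of measurable sets with summable successive distances converges to its lower limit
`⋃ n, ⋂ k ≥ n, u k`. -/
instance : CompleteSpace (MeasuredSets μ) := by
  have hB : ∀ N : ℕ, (0 : ℝ≥0∞) < 2⁻¹ ^ N := fun N => ENNReal.pow_pos (by simp) N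
  refine EMetric.complete_of_convergent_controlled_sequences (fun N => 2⁻¹ ^ N) hB fun u hu => ?_
  have hLm : MeasurableSet (⋃ n, ⋂ k, (u (n + k) : Set X)) :=
    .iUnion fun n => .iInter fun k => (u (n + k)).2
  let L : MeasuredSets μ := ⟨⋃ n, ⋂ k, (u (n + k) : Set X), hLm⟩
  refine ⟨L, tendsto_iff_edist_tendsto_0.2 ?_⟩
  have hbound : ∀ n, edist (u n) L ≤ 2 * 2⁻¹ ^ n := by
    intro n
    have hsub : (u n : Set X) ∆ (⋃ n, ⋂ k, (u (n + k) : Set X)) ⊆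
        ⋃ k, (u (n + k) : Set X) ∆ (u (n + k + 1) : Set X) := by
      intro x hx
      by_contra hno
      simp only [Set.mem_iUnion, not_exists, Set.mem_symmDiff, not_or, not_and, not_not] at hno
      have hconst : ∀ k, x ∈ (u (n + k) : Set X) ↔ x ∈ (u n : Set X) := by
        intro k
        induction k with
        | zero => rfl
        | succ k ih => exact ⟨fun h => ih.1 ((hno k).2 h), fun h => (hno k).1 (ih.2 h)⟩
      have hiff : x ∈ (⋃ n, ⋂ k, (u (n + k) : Set X)) ↔ x ∈ (u n : Set X) := by
        simp only [Set.mem_iUnion, Set.mem_iInter]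
        refine ⟨fun ⟨m, hm⟩ => (hconst m).1 ?_, fun h => ⟨n, fun k => (hconst k).2 h⟩⟩
        rw [add_comm]
        exact hm n
      rw [Set.mem_symmDiff, hiff] at hx
      tauto
    calc μ ((u n : Set X) ∆ (⋃ n, ⋂ k, (u (n + k) : Set X)))
        ≤ ∑' k, μ ((u (n + k) : Set X) ∆ (u (n + k + 1) : Set X)) :=
          (measure_mono hsub).trans (measure_iUnion_le _)
      _ ≤ ∑' k, 2⁻¹ ^ n * 2⁻¹ ^ k := ENNReal.tsum_le_tsum fun k => by
          rw [← pow_add]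
          exact (hu (n + k) _ _ le_rfl (Nat.le_succ _)).le
      _ = 2 * 2⁻¹ ^ n := by
          rw [ENNReal.tsum_mul_left, ENNReal.tsum_geometric, ENNReal.one_sub_inv_two, inv_inv,
            mul_comm]
  have hlim : Tendsto (fun n : ℕ => (2 : ℝ≥0∞) * 2⁻¹ ^ n) atTop (𝓝 0) := by
    have h := ENNReal.Tendsto.const_mul (a := 2)
      (ENNReal.tendsto_pow_atTop_nhds_zero_of_lt_one (r := 2⁻¹) (by simp)) (Or.inr (by simp))
    simpa using h
  exact tendsto_of_tendsto_of_tendsto_of_le_of_le tendsto_const_nhds hlim (fun _ => zero_le)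
    hbound

end MeasureAlgebra

/-! ### Measure algebra maps -/

namespace MeasureAlgebraMap

open MeasureAlgebra Filter

variable {Y X Z : Type*} [MeasurableSpace Y] [MeasurableSpace X] [MeasurableSpace Z]
  {ν : Measure Y} {μ : Measure X} {m : Measure Z}

theorem isometry (S : MeasureAlgebraMap ν μ) : Isometry S.toFun := fun A B => by
  rw [edist_eq_measure, edist_eq_measure, ← S.map_compl, ← S.map_compl, ← S.map_sup, ← S.map_sup,
    ← S.map_compl, ← S.map_compl, ← S.map_sup, S.measure_map]

theorem toFun_injective :
    Function.Injective (toFun : MeasureAlgebraMap ν μ → MeasureAlgebra ν → MeasureAlgebra μ) := by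
  rintro ⟨_, _⟩ ⟨_, _⟩ rfl
  rfl

/-- The composition of measure algebra maps. -/
def comp (S : MeasureAlgebraMap ν μ) (T : MeasureAlgebraMap m ν) : MeasureAlgebraMap m μ where
  toFun A := S.toFun (T.toFun A)
  map_top := by rw [T.map_top, S.map_top]
  map_bot := by rw [T.map_bot, S.map_bot]
  map_sup A B := by rw [T.map_sup, S.map_sup]
  map_compl A := by rw [T.map_compl, S.map_compl]
  measure_map A := by rw [S.measure_map, T.measure_map]

theorem IsIso.comp {S : MeasureAlgebraMap ν μ} {T : MeasureAlgebraMap m ν} (hS : S.IsIso)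
    (hT : T.IsIso) : (S.comp T).IsIso := by
  obtain ⟨S', hS'l, hS'r⟩ := hS
  obtain ⟨T', hT'l, hT'r⟩ := hT
  exact ⟨T'.comp S', hS'l.comp hT'l, hS'r.comp hT'r⟩

theorem isIso_of_surjective {S : MeasureAlgebraMap ν μ} (hS : Function.Surjective S.toFun) :
    S.IsIso := by
  have hinj := S.isometry.injective
  have hr := Function.rightInverse_surjInv hS
  refine ⟨⟨Function.surjInv hS, hinj ?_, hinj ?_, fun A B => hinj ?_, fun A => hinj ?_,
    fun A => ?_⟩, Function.leftInverse_surjInv ⟨hinj, hS⟩, hr⟩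
  · rw [hr, S.map_top]
  · rw [hr, S.map_bot]
  · rw [S.map_sup, hr, hr, hr]
  · rw [S.map_compl, hr, hr]
  · rw [← S.measure_map, hr]

/-- The range of an isometry of a complete space is closed, so that it is everything as soon as it
is dense. -/
theorem isIso_iff_denseRange {S : MeasureAlgebraMap ν μ} : S.IsIso ↔ DenseRange S.toFun := by
  refine ⟨fun ⟨_, _, hr⟩ => hr.surjective.denseRange, fun h => isIso_of_surjective ?_⟩
  rw [← Set.range_eq_univ, ← S.isometry.isClosedEmbedding.isClosed_range.closure_eq]
  exact h.closure_range

/-- The measure algebra map induced by a measure preserving map: taking preimages. -/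
noncomputable def ofMeasurePreserving {f : Y → Z} (hf : MeasurePreserving f ν m) :
    MeasureAlgebraMap m ν where
  toFun := Quotient.map
    (fun s : MeasuredSets m => (⟨f ⁻¹' s.1, hf.measurable s.2⟩ : MeasuredSets ν)) (by
      intro s t h
      refine (inseparable_iff _ _).2 ?_
      have h' := (inseparable_iff _ _).1 h
      exact (hf.measure_preimage (s.2.symmDiff t.2).nullMeasurableSet).trans h')
  map_top := rfl
  map_bot := rfl
  map_sup A B := by
    obtain ⟨s, hs, rfl⟩ := exists_ofSet_eq A
    obtain ⟨t, ht, rfl⟩ := exists_ofSet_eq B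
    rfl
  map_compl A := by
    obtain ⟨s, hs, rfl⟩ := exists_ofSet_eq A
    rfl
  measure_map A := by
    obtain ⟨s, hs, rfl⟩ := exists_ofSet_eq A
    exact hf.measure_preimage hs.nullMeasurableSet

theorem ofMeasurePreserving_ofSet {f : Y → Z} (hf : MeasurePreserving f ν m) {s : Set Z}
    (hs : MeasurableSet s) :
    (ofMeasurePreserving hf).toFun (ofSet m s hs) = ofSet ν (f ⁻¹' s) (hf.measurable hs) := rfl

/-! ### The topology of pointwise convergence -/

theorem continuous_toFun :
    Continuous (toFun : MeasureAlgebraMap ν μ → MeasureAlgebra ν → MeasureAlgebra μ) :=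
  continuous_induced_dom

theorem continuous_apply (A : MeasureAlgebra ν) :
    Continuous fun S : MeasureAlgebraMap ν μ => S.toFun A :=
  (_root_.continuous_apply A).comp continuous_toFun

/-- Since measure algebra maps are isometries, pointwise convergence on a dense sequence implies
pointwise convergence everywhere. -/
theorem isInducing_restrict {D : ℕ → MeasureAlgebra ν} (hD : DenseRange D) :
    IsInducing fun (S : MeasureAlgebraMap ν μ) n => S.toFun (D n) := by
  refine ⟨le_antisymm (continuous_pi fun n => continuous_apply (D n)).le_induced ?_⟩
  refine continuous_iff_le_induced.1 ?_
  let _ : TopologicalSpace (MeasureAlgebraMap ν μ) :=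
    .induced (fun S n => S.toFun (D n)) Pi.topologicalSpace
  have hres : Continuous fun (S : MeasureAlgebraMap ν μ) n => S.toFun (D n) :=
    continuous_induced_dom
  refine continuous_pi fun A => continuous_of_uniform_approx_of_continuous fun u hu => ?_
  obtain ⟨ε, hε, hεu⟩ := mem_uniformity_edist.1 hu
  obtain ⟨_, ⟨n, rfl⟩, hn⟩ := EMetric.mem_closure_iff.1 (hD A) ε hε
  refine ⟨fun S => S.toFun (D n), continuous_pi_iff.1 hres n, fun S => hεu ?_⟩
  rw [S.isometry.edist_eq]
  exact hn

theorem injective_restrict {D : ℕ → MeasureAlgebra ν} (hD : DenseRange D) :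
    Function.Injective fun (S : MeasureAlgebraMap ν μ) n => S.toFun (D n) := fun S T h =>
  toFun_injective <| hD.equalizer S.isometry.continuous T.isometry.continuous h

/-- A sequence of measure algebra maps that converges on a dense sequence is Cauchy at every point,
and its pointwise limit is a measure algebra map because the operations are continuous. -/
theorem isClosed_range_restrict {D : ℕ → MeasureAlgebra ν} (hD : DenseRange D) :
    IsClosed (Set.range fun (S : MeasureAlgebraMap ν μ) n => S.toFun (D n)) := by
  refine IsSeqClosed.isClosed fun u f hu hf => ?_
  choose S hS using hu
  have hSD : ∀ k, Tendsto (fun n => (S n).toFun (D k)) atTop (𝓝 (f k)) := fun k => by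
    have h := (tendsto_pi_nhds.1 hf) k
    refine h.congr fun n => ?_
    rw [← hS]
  have hlim : ∀ A, ∃ B, Tendsto (fun n => (S n).toFun A) atTop (𝓝 B) := by
    intro A
    refine cauchySeq_tendsto_of_complete (EMetric.cauchySeq_iff.2 fun ε hε => ?_)
    have hε3 : 0 < ε / 3 := ENNReal.div_pos hε.ne' (by simp)
    obtain ⟨_, ⟨k, rfl⟩, hk⟩ := EMetric.mem_closure_iff.1 (hD A) (ε / 3) hε3
    obtain ⟨N, hN⟩ := EMetric.cauchySeq_iff.1 (hSD k).cauchySeq (ε / 3) hε3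
    refine ⟨N, fun i hi j hj => ?_⟩
    calc edist ((S i).toFun A) ((S j).toFun A)
        ≤ edist ((S i).toFun A) ((S i).toFun (D k)) +
          edist ((S i).toFun (D k)) ((S j).toFun (D k)) +
          edist ((S j).toFun (D k)) ((S j).toFun A) := edist_triangle4 _ _ _ _
      _ < ε / 3 + ε / 3 + ε / 3 := by
        rw [(S i).isometry.edist_eq, (S j).isometry.edist_eq, edist_comm (D k)]
        exact ENNReal.add_lt_add (ENNReal.add_lt_add hk (hN i hi j hj)) hk
      _ = ε := ENNReal.add_thirds ε
  choose T hT using hlim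
  refine ⟨⟨T, ?_, ?_, fun A B => ?_, fun A => ?_, fun A => ?_⟩, ?_⟩
  · exact tendsto_nhds_unique (hT ⊤) (by simp only [map_top]; exact tendsto_const_nhds)
  · exact tendsto_nhds_unique (hT ⊥) (by simp only [map_bot]; exact tendsto_const_nhds)
  · refine tendsto_nhds_unique (hT (A ⊔ B)) ?_
    simp only [map_sup]
    exact (MeasureAlgebra.continuous_sup.tendsto (T A, T B)).comp ((hT A).prodMk_nhds (hT B))
  · refine tendsto_nhds_unique (hT Aᶜ) ?_
    simp only [map_compl]
    exact (continuous_compl.tendsto (T A)).comp (hT A)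
  · refine tendsto_nhds_unique ((continuous_measure.tendsto (T A)).comp (hT A)) ?_
    simp only [Function.comp_def, measure_map]
    exact tendsto_const_nhds
  · exact funext fun k => tendsto_nhds_unique (hT (D k)) (hSD k)

theorem isCompletelyMetrizableSpace [IsFiniteMeasure μ] [SeparableSpace (MeasureAlgebra ν)] :
    IsCompletelyMetrizableSpace (MeasureAlgebraMap ν μ) := by
  have : Nonempty (MeasureAlgebra ν) := ⟨⊥⟩
  have hD := denseRange_denseSeq (MeasureAlgebra ν)
  exact Topology.IsClosedEmbedding.IsCompletelyMetrizableSpace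
    ⟨⟨isInducing_restrict hD, injective_restrict hD⟩, isClosed_range_restrict hD⟩

theorem isGδ_setOf_isIso [SeparableSpace (MeasureAlgebra μ)] :
    IsGδ {S : MeasureAlgebraMap ν μ | S.IsIso} := by
  have : Nonempty (MeasureAlgebra μ) := ⟨⊥⟩
  have hE := denseRange_denseSeq (MeasureAlgebra μ)
  set E := denseSeq (MeasureAlgebra μ)
  have heq : {S : MeasureAlgebraMap ν μ | S.IsIso} = ⋂ n : ℕ, ⋂ k : ℕ, ⋃ A : MeasureAlgebra ν,
      {S | edist (E n) (S.toFun A) < (k + 1 : ℝ≥0∞)⁻¹} := by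
    ext S
    simp only [Set.mem_ofPred_eq, Set.mem_iInter, Set.mem_iUnion, isIso_iff_denseRange]
    constructor
    · intro h n k
      obtain ⟨_, ⟨A, rfl⟩, hA⟩ := EMetric.mem_closure_iff.1 (h (E n)) (k + 1 : ℝ≥0∞)⁻¹ (by simp)
      exact ⟨A, hA⟩
    · intro h
      refine dense_closure.1 (hE.mono (Set.range_subset_iff.2 fun n => ?_))
      refine EMetric.mem_closure_iff.2 fun ε hε => ?_
      obtain ⟨k, hk⟩ := ENNReal.exists_inv_nat_lt hε.ne'
      obtain ⟨A, hA⟩ := h n k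
      exact ⟨_, ⟨A, rfl⟩, hA.trans_le ((ENNReal.inv_le_inv.2 le_self_add).trans hk.le)⟩
  rw [heq]
  exact .iInter fun n => .iInter fun k => (isOpen_iUnion fun A =>
    isOpen_lt (continuous_const.edist (continuous_apply A)) continuous_const).isGδ

end MeasureAlgebraMap

/-! ### Back and forth -/

section BackAndForth

open MeasureAlgebra

variable {Y X : Type*} [MeasurableSpace Y] [MeasurableSpace X] {ν : Measure Y} {μ : Measure X}

/-- A measure algebra map carries a partition that resolves finitely many given classes to a
partition of the target, cell by cell. -/
theorem MeasureAlgebraMap.exists_coding (S : MeasureAlgebraMap ν μ)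
    (F : Finset (MeasureAlgebra ν)) :
    ∃ (φ : Y → ℕ) (hφ : Measurable φ) (ψ : X → ℕ) (hψ : Measurable ψ),
      (∀ C : Set ℕ, S.toFun (ofSet ν (φ ⁻¹' C) (hφ .of_discrete)) =
        ofSet μ (ψ ⁻¹' C) (hψ .of_discrete)) ∧
      ∀ A ∈ F, ∃ C : Set ℕ, ofSet ν (φ ⁻¹' C) (hφ .of_discrete) = A := by
  classical
  induction F using Finset.induction_on with
  | empty =>
    refine ⟨fun _ => 0, measurable_const, fun _ => 0, measurable_const, fun C => ?_, by simp⟩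
    by_cases h0 : 0 ∈ C
    · rw [ofSet_congr _ (Set.preimage_const_of_mem h0),
        ofSet_congr _ (Set.preimage_const_of_mem h0)]
      exact S.map_top
    · rw [ofSet_congr _ (Set.preimage_const_of_notMem h0),
        ofSet_congr _ (Set.preimage_const_of_notMem h0)]
      exact S.map_bot
  | insert A F _ ih =>
    obtain ⟨φ, hφ, ψ, hψ, hS, hF⟩ := ih
    obtain ⟨a, ha, rfl⟩ := exists_ofSet_eq A
    obtain ⟨b, hb, hSa⟩ := exists_ofSet_eq (S.toFun (ofSet ν a ha))
    refine ⟨appendBit φ a, measurable_appendBit hφ ha, appendBit ψ b, measurable_appendBit hψ hb,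
      fun C => ?_, fun A hA => ?_⟩
    · have hmφ : ∀ C, MeasurableSet (φ ⁻¹' C) := fun C => hφ .of_discrete
      have hmψ : ∀ C, MeasurableSet (ψ ⁻¹' C) := fun C => hψ .of_discrete
      rw [ofSet_congr _ (preimage_appendBit φ a C), ofSet_congr _ (preimage_appendBit ψ b C),
        ← ofSet_sup ((hmφ _).inter ha) ((hmφ _).diff ha),
        ← ofSet_sup ((hmψ _).inter hb) ((hmψ _).diff hb), ofSet_inter (hmφ _) ha,
        ofSet_diff (hmφ _) ha, ofSet_inter (hmψ _) hb, ofSet_diff (hmψ _) hb]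
      simp only [S.map_sup, S.map_compl, hS, hSa]
    · rcases Finset.mem_insert.1 hA with rfl | hA
      · exact ⟨_, ofSet_congr _ (preimage_appendBit_odd φ a)⟩
      · obtain ⟨C, hC⟩ := hF A hA
        refine ⟨{z | z / 2 ∈ C}, ?_⟩
        rw [← hC]
        refine ofSet_congr _ ?_
        ext y
        simp [appendBit_div_two]

/-- One step of the back-and-forth construction: two partitions with the same distribution have
refinements with the same distribution which resolve prescribed sets `A` and `B`. -/
theorem IsNonatomic.exists_refinement [IsFiniteMeasure ν] [IsFiniteMeasure μ]
    (hν : IsNonatomic ν) (hμ : IsNonatomic μ) {φ : Y → ℕ} {ψ : X → ℕ} (hφ : Measurable φ)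
    (hψ : Measurable ψ) (h : ν.map φ = μ.map ψ) {A : Set Y} (hA : MeasurableSet A) {B : Set X}
    (hB : MeasurableSet B) :
    ∃ (φ' : Y → ℕ) (ψ' : X → ℕ), Measurable φ' ∧ Measurable ψ' ∧ ν.map φ' = μ.map ψ' ∧
      (∀ y, φ' y / 4 = φ y) ∧ (∀ x, ψ' x / 4 = ψ x) ∧
      (∃ C, φ' ⁻¹' C = A) ∧ ∃ C, ψ' ⁻¹' C = B := by
  obtain ⟨B', hB', h1⟩ := hμ.exists_map_appendBit_eq hφ hψ h hA
  have hφ1 := measurable_appendBit hφ hA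
  have hψ1 := measurable_appendBit hψ hB'
  obtain ⟨A', hA', h2⟩ := hν.exists_map_appendBit_eq hψ1 hφ1 h1.symm hB
  refine ⟨_, _, measurable_appendBit hφ1 hA', measurable_appendBit hψ1 hB, h2.symm,
    fun y => ?_, fun x => ?_, ⟨{z | z / 2 % 2 = 1}, ?_⟩, _, preimage_appendBit_odd _ _⟩
  · rw [← Nat.div_div_eq_div_mul _ 2 2, appendBit_div_two, appendBit_div_two]
  · rw [← Nat.div_div_eq_div_mul _ 2 2, appendBit_div_two, appendBit_div_two]
  · refine Eq.trans ?_ (preimage_appendBit_odd φ A)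
    ext y
    simp [appendBit_div_two]

/-- Two partitions with the same distribution are the start of sequences of partitions with the
same distributions, each coarser than the next one, which resolve all sets of given sequences. -/
theorem IsNonatomic.exists_refining_sequences [IsFiniteMeasure ν] [IsFiniteMeasure μ]
    (hν : IsNonatomic ν) (hμ : IsNonatomic μ) {φ₀ : Y → ℕ} {ψ₀ : X → ℕ} (hφ₀ : Measurable φ₀)
    (hψ₀ : Measurable ψ₀) (h₀ : ν.map φ₀ = μ.map ψ₀) {A : ℕ → Set Y}
    (hA : ∀ n, MeasurableSet (A n)) {B : ℕ → Set X} (hB : ∀ n, MeasurableSet (B n)) :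
    ∃ (φ : ℕ → Y → ℕ) (ψ : ℕ → X → ℕ), φ 0 = φ₀ ∧ ψ 0 = ψ₀ ∧ (∀ n, Measurable (φ n)) ∧
      (∀ n, Measurable (ψ n)) ∧ (∀ n, ν.map (φ n) = μ.map (ψ n)) ∧
      (∀ n y, φ (n + 1) y / 4 = φ n y) ∧ (∀ n x, ψ (n + 1) x / 4 = ψ n x) ∧
      (∀ n, ∃ C, φ (n + 1) ⁻¹' C = A n) ∧ ∀ n, ∃ C, ψ (n + 1) ⁻¹' C = B n := by
  let P := {p : (Y → ℕ) × (X → ℕ) // Measurable p.1 ∧ Measurable p.2 ∧ ν.map p.1 = μ.map p.2}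
  have step : ∀ (n : ℕ) (p : P), ∃ q : P, (∀ y, q.1.1 y / 4 = p.1.1 y) ∧
      (∀ x, q.1.2 x / 4 = p.1.2 x) ∧ (∃ C, q.1.1 ⁻¹' C = A n) ∧ ∃ C, q.1.2 ⁻¹' C = B n := by
    rintro n ⟨⟨φ, ψ⟩, hφ, hψ, h⟩
    obtain ⟨φ', ψ', hφ', hψ', h', hr⟩ := hν.exists_refinement hμ hφ hψ h (hA n) (hB n)
    exact ⟨⟨(φ', ψ'), hφ', hψ', h'⟩, hr⟩
  choose next hnext using step
  let s : ℕ → P := fun n => Nat.rec ⟨(φ₀, ψ₀), hφ₀, hψ₀, h₀⟩ next n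
  exact ⟨fun n => (s n).1.1, fun n => (s n).1.2, rfl, rfl, fun n => (s n).2.1,
    fun n => (s n).2.2.1, fun n => (s n).2.2.2, fun n => (hnext n (s n)).1,
    fun n => (hnext n (s n)).2.1, fun n => (hnext n (s n)).2.2.1, fun n => (hnext n (s n)).2.2.2⟩

/-- A measure algebra map agrees with an isomorphism on any finite set of classes. Back and forth
yields maps from `Y` and `X` to the space of integer sequences with the same image measure `m`, each
inducing an isomorphism from the measure algebra of `m`; the isomorphism sought is the composition
of one of them with the inverse of the other one. -/
theorem MeasureAlgebraMap.exists_isIso_eqOn [IsFiniteMeasure ν] [IsFiniteMeasure μ]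
    [SeparableSpace (MeasureAlgebra ν)] [SeparableSpace (MeasureAlgebra μ)]
    (hν : IsNonatomic ν) (hμ : IsNonatomic μ) (S : MeasureAlgebraMap ν μ)
    (F : Finset (MeasureAlgebra ν)) :
    ∃ T : MeasureAlgebraMap ν μ, T.IsIso ∧ ∀ A ∈ F, T.toFun A = S.toFun A := by
  have : Nonempty (MeasureAlgebra ν) := ⟨⊥⟩
  have : Nonempty (MeasureAlgebra μ) := ⟨⊥⟩
  choose a ha hadense using fun n => exists_ofSet_eq (denseSeq (MeasureAlgebra ν) n)
  choose b hb hbdense using fun n => exists_ofSet_eq (denseSeq (MeasureAlgebra μ) n)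
  obtain ⟨φ₀, hφ₀, ψ₀, hψ₀, hS, hF⟩ := S.exists_coding F
  have h₀ : ν.map φ₀ = μ.map ψ₀ := by
    ext C -
    rw [Measure.map_apply hφ₀ .of_discrete, Measure.map_apply hψ₀ .of_discrete,
      ← measure_ofSet (hφ₀ .of_discrete), ← measure_ofSet (hψ₀ .of_discrete), ← hS, S.measure_map]
  obtain ⟨φ, ψ, rfl, rfl, hφ, hψ, h, hφ4, hψ4, hφa, hψb⟩ :=
    hν.exists_refining_sequences hμ hφ₀ hψ₀ h₀ ha hb
  set m : Measure (ℕ → ℕ) := ν.map fun y n => φ n y with hm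
  have hpφ : MeasurePreserving (fun y n => φ n y) ν m := ⟨measurable_pi_lambda _ hφ, rfl⟩
  have hpψ : MeasurePreserving (fun x n => ψ n x) μ m :=
    ⟨measurable_pi_lambda _ hψ, (map_sequence_eq (g := (· / 4)) hφ hψ h hφ4 hψ4).symm⟩
  have hcyl : ∀ (n : ℕ) (C : Set ℕ), MeasurableSet {z : ℕ → ℕ | z n ∈ C} := fun n C =>
    measurable_pi_apply n .of_discrete
  have hisoφ : (ofMeasurePreserving hpφ).IsIso := by
    refine isIso_iff_denseRange.2
      ((denseRange_denseSeq _).mono (Set.range_subset_iff.2 fun n => ?_))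
    obtain ⟨C, hC⟩ := hφa n
    refine ⟨ofSet m _ (hcyl (n + 1) C), ?_⟩
    rw [ofMeasurePreserving_ofSet, ← hadense]
    exact ofSet_congr _ hC
  have hisoψ : (ofMeasurePreserving hpψ).IsIso := by
    refine isIso_iff_denseRange.2
      ((denseRange_denseSeq _).mono (Set.range_subset_iff.2 fun n => ?_))
    obtain ⟨C, hC⟩ := hψb n
    refine ⟨ofSet m _ (hcyl (n + 1) C), ?_⟩
    rw [ofMeasurePreserving_ofSet, ← hbdense]
    exact ofSet_congr _ hC
  obtain ⟨R, hRl, hRr⟩ := hisoφ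
  refine ⟨(ofMeasurePreserving hpψ).comp R, hisoψ.comp ⟨_, hRr, hRl⟩, fun A hA => ?_⟩
  obtain ⟨C, rfl⟩ := hF A hA
  have hRC : R.toFun (ofSet ν (φ 0 ⁻¹' C) (hφ₀ .of_discrete)) = ofSet m _ (hcyl 0 C) :=
    hRl (ofSet m _ (hcyl 0 C))
  rw [hS]
  exact congrArg (ofMeasurePreserving hpψ).toFun hRC

theorem MeasureAlgebraMap.dense_setOf_isIso [IsFiniteMeasure ν] [IsFiniteMeasure μ]
    [SeparableSpace (MeasureAlgebra ν)] [SeparableSpace (MeasureAlgebra μ)]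
    (hν : IsNonatomic ν) (hμ : IsNonatomic μ) : Dense {S : MeasureAlgebraMap ν μ | S.IsIso} := by
  rw [dense_iff_inter_open]
  rintro _ ⟨V, hV, rfl⟩ ⟨S, hS⟩
  obtain ⟨F, u, hu, hFV⟩ := isOpen_pi_iff.1 hV _ hS
  obtain ⟨T, hT, hTS⟩ := S.exists_isIso_eqOn hν hμ F
  refine ⟨T, hFV fun A hA => ?_, hT⟩
  have h : S.toFun A ∈ u A := (hu A hA).2
  rwa [← hTS A hA] at h

end BackAndForth

theorem theorem3p06 {Y X : Type*} [MeasurableSpace Y] [MeasurableSpace X]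
    (ν : Measure Y) (μ : Measure X) [IsFiniteMeasure ν] [IsFiniteMeasure μ]
    (hνsep : SeparableSpace (MeasureAlgebra ν)) (hμsep : SeparableSpace (MeasureAlgebra μ))
    (hν : IsNonatomic ν) (hμ : IsNonatomic μ) :
    IsCompletelyMetrizableSpace (MeasureAlgebraMap ν μ) ∧
      Dense {S : MeasureAlgebraMap ν μ | S.IsIso} ∧
      IsGδ {S : MeasureAlgebraMap ν μ | S.IsIso} ∧
      ∀ᶠ S in residual (MeasureAlgebraMap ν μ), S.IsIso :=
  have hdense := MeasureAlgebraMap.dense_setOf_isIso hν hμ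
  ⟨MeasureAlgebraMap.isCompletelyMetrizableSpace, hdense, MeasureAlgebraMap.isGδ_setOf_isIso,
    residual_of_dense_Gδ MeasureAlgebraMap.isGδ_setOf_isIso hdense⟩
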